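/- Let $2^\omega$ carry the product topology, coordinatewise addition mod $2$ and the standard product (fair coin) measure. A family $\mathcal J$ of subsets of a topological space $X$ is an $\omega$-cover of $X$ if every finite $F\subseteq X$ is contained in some $B\in\mathcal J$. The space $X$ is a $\gamma$-set if every $\omega$-cover $\mathcal J$ of $X$ consisting of open sets contains a sequence $\langle D_n:n\in\omega\rangle$ of elements of $\mathcal J$ with $X\subseteq\bigcup_m\bigcap_{n>m}D_n$; $X \subseteq 2^\omega$ is a hereditarily $\gamma$-set if every subset of $X$, with the subspace topology, is a $\gamma$-set. A set $X\subseteq 2^\omega$ is strongly meager if $X+H\neq 2^\omega$ for every measure zero set $H\subseteq 2^\omega$. For $n\in\omega$ let $k_n=\sum_{i=0}^n 2^i$, let $A_n=\{x\in 2^\omega: x(i)=0\text{ for all } i\in[k_n,k_{n+1})\}$, and let $G=\bigcap_m\bigcup_{n>m}A_n$. Theorem. Assume Jensen's principle $\diamondsuit$: there are sets $S_\alpha\subseteq\alpha$ for $\alpha<\omega_1$ such that for every $S\subseteq\omega_1$ the set $\{\alpha<\omega_1: S\cap\alpha=S_\alpha\}$ is stationary in $\omega_1$. Then $G$ has measure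 zero, and there is a hereditarily $\gamma$-set $X\subseteq 2^\omega$ that is not strongly meager; moreover, $X$ can be chosen with $X+G=2^\omega$. -/

import Mathlib

open MeasureTheory Set
open scoped Pointwise Ordinal

/-- The set `ω₁` of countable ordinals, as a well-ordered type. -/
abbrev OmegaOne : Type := (ω₁ : Ordinal.{0}).ToType

/-- Jensen's principle `◇`: there is a sequence `A α ⊆ α` (`α < ω₁`) such that every `S ⊆ ω₁` is
guessed correctly, `S ∩ α = A α`, for stationarily many `α < ω₁`. -/
def Diamond : Prop :=
  ∃ A : OmegaOne → Set OmegaOne, (∀ α, A α ⊆ Iio α) ∧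
    ∀ S : Set OmegaOne, IsStationary {α : OmegaOne | S ∩ Iio α = A α}

/-- The space `2^ω`: its topology is the product of discrete topologies, and its addition is
coordinatewise addition mod 2. -/
abbrev Cantor : Type := ℕ → ZMod 2

/-- The standard product (fair coin tossing) measure on `2^ω`. -/
noncomputable def cantorMeasure : Measure Cantor :=
  Measure.infinitePi fun _ : ℕ => ProbabilityTheory.uniformOn (univ : Set (ZMod 2))

/-- A family `J` of subsets of `X` is an `ω`-cover of `X` if every finite subset of `X` is contained
in a member of `J`. -/
def IsOmegaCover {X : Type*} (J : Set (Set X)) : Prop :=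
  ∀ F : Set X, F.Finite → ∃ B ∈ J, F ⊆ B

/-- A topological space `X` is a `γ`-set if every open `ω`-cover `J` of `X` contains a sequence
`D 0, D 1, …` with `X ⊆ ⋃ m, ⋂ n > m, D n`. -/
def IsGammaSpace (X : Type*) [TopologicalSpace X] : Prop :=
  ∀ J : Set (Set X), (∀ U ∈ J, IsOpen U) → IsOmegaCover J →
    ∃ D : ℕ → Set X, (∀ n, D n ∈ J) ∧ (⋃ m : ℕ, ⋂ n > m, D n) = univ

/-- `X ⊆ 2^ω` is a hereditarily `γ`-set if every subset of `X`, with the subspace topology, is a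
`γ`-set. -/
def IsHereditarilyGamma (X : Set Cantor) : Prop :=
  ∀ Y : Set Cantor, Y ⊆ X → IsGammaSpace Y

/-- `X ⊆ 2^ω` is strongly meager if `X + H ≠ 2^ω` for every null set `H ⊆ 2^ω`. -/
def IsStronglyMeager (X : Set Cantor) : Prop :=
  ∀ H : Set Cantor, cantorMeasure H = 0 → X + H ≠ univ

/-- `k n = 2^0 + 2^1 + ⋯ + 2^n`. -/
def blockStart (n : ℕ) : ℕ := ∑ i ∈ Finset.range (n + 1), 2 ^ i

/-- The clopen set of all `x ∈ 2^ω` that vanish on the interval `[k n, k (n + 1))`. -/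
def zeroOnBlock (n : ℕ) : Set Cantor :=
  {x | ∀ i ∈ Ico (blockStart n) (blockStart (n + 1)), x i = 0}

/-- The set `G` of all `x ∈ 2^ω` that vanish on `[k n, k (n + 1))` for infinitely many `n`. -/
def blockNullSet : Set Cantor := ⋂ m : ℕ, ⋃ n > m, zeroOnBlock n

/-! By recursion on $\alpha<\omega_1$, build countable families $N_\alpha$ of fat closed sets. Every
nonempty clopen set and every member of an earlier family has a subset in $N_\alpha$, while $\bigcup
N_\alpha$ decreases with $\alpha$. Each stage contributes one point $x_\alpha\in\bigcup N_\alpha$ to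
$X$. By Baire category a fat set contains some $x$ with $z-x\in G$
(`IsFat.exists_sub_mem_blockNullSet`), so $x_\alpha$ can serve a prescribed $z_\alpha$; by ◇ every
$z$ is some $z_\alpha$, whence $X+G=2^\omega$.

For the γ-property, ◇ also guesses a clopen ω-cover of some $Y\subseteq X$ and the early points of
$Y$. Stage $\alpha$ picks $D_n$ in the cover such that each early point of $Y$ is in almost all
$D_n$, and each $q\in N_\alpha$ lies either inside almost all $D_n$ or inside an earlier set missing
the early points of $Y$ (`IsFatFamily.exists_refinement`, by fusion). Points $x_\beta$ with
$\beta\ge\alpha$ lie in $\bigcup N_\alpha$. When $\alpha$ is a suitable closure point, an earlier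
set missing the early points of $Y$ misses $Y$, so the $D_n$ work for all of $Y$. -/

/-! ### The set $G$ is null (Borel–Cantelli) -/

theorem blockStart_succ (n : ℕ) : blockStart (n + 1) = blockStart n + 2 ^ (n + 1) := by
  simp [blockStart, Finset.sum_range_succ _ (n + 1)]

theorem le_blockStart (n : ℕ) : n ≤ blockStart n := by
  induction n with
  | zero => simp
  | succ n ih =>
    rw [blockStart_succ]
    have := Nat.one_le_two_pow (n := n + 1)
    omega

theorem cantorMeasure_zeroOnBlock_le (n : ℕ) :
    cantorMeasure (zeroOnBlock n) ≤ (2⁻¹ : ENNReal) ^ n := by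
  have hset : zeroOnBlock n =
      Set.pi (Finset.Ico (blockStart n) (blockStart (n + 1)) : Set ℕ) fun _ => {0} := by
    ext x
    simp [zeroOnBlock]
  have : IsProbabilityMeasure (ProbabilityTheory.uniformOn (univ : Set (ZMod 2))) :=
    ProbabilityTheory.isProbabilityMeasure_uniformOn finite_univ univ_nonempty
  have hpt : ProbabilityTheory.uniformOn (univ : Set (ZMod 2)) {0} = 2⁻¹ := by
    rw [ProbabilityTheory.uniformOn_univ]
    simp [ZMod.card]
  rw [hset, cantorMeasure, Measure.infinitePi_pi _ (fun _ _ => measurableSet_singleton _)]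
  simp only [hpt, Finset.prod_const, Nat.card_Ico, blockStart_succ, Nat.add_sub_cancel_left]
  refine pow_le_pow_right_of_le_one' (by simp) ?_
  exact (Nat.le_succ n).trans (Nat.lt_two_pow_self).le

theorem cantorMeasure_blockNullSet : cantorMeasure blockNullSet = 0 := by
  have hsum : ∑' n, cantorMeasure (zeroOnBlock n) ≠ ⊤ := by
    refine ne_top_of_le_ne_top ?_ (ENNReal.tsum_le_tsum cantorMeasure_zeroOnBlock_le)
    rw [ENNReal.tsum_geometric]
    simp
  refine measure_mono_null ?_ (measure_limsup_atTop_eq_zero hsum)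
  intro x hx
  simp only [blockNullSet, mem_iInter, mem_iUnion] at hx
  rw [Filter.mem_limsup_iff_frequently_mem, Filter.frequently_atTop]
  intro m
  obtain ⟨n, hn, h⟩ := hx m
  exact ⟨n, le_of_lt hn, h⟩

theorem mem_blockNullSet {x : Cantor} :
    x ∈ blockNullSet ↔ ∀ m, ∃ n > m, x ∈ zeroOnBlock n := by
  simp [blockNullSet]

/-! ### Fat closed sets -/

/-- The clopen set of all points agreeing with `a` on the `n`-th block. -/
def blockCylinder (a : Cantor) (n : ℕ) : Set Cantor :=
  {x | ∀ i ∈ Ico (blockStart n) (blockStart (n + 1)), x i = a i}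

theorem isClopen_blockCylinder (a : Cantor) (n : ℕ) : IsClopen (blockCylinder a n) := by
  have : blockCylinder a n =
      ⋂ i ∈ Finset.Ico (blockStart n) (blockStart (n + 1)), (fun x : Cantor => x i) ⁻¹' {a i} := by
    ext x
    simp [blockCylinder]
  rw [this]
  exact isClopen_biInter_finset fun i _ => (isClopen_discrete _).preimage (continuous_apply i)

theorem isClopen_cylinder (x : Cantor) (n : ℕ) :
    IsClopen (PiNat.cylinder (E := fun _ => ZMod 2) x n) := by
  have : PiNat.cylinder (E := fun _ => ZMod 2) x n =
      ⋂ i ∈ Finset.range n, (fun x : Cantor => x i) ⁻¹' {x i} := by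
    ext y
    simp [PiNat.cylinder]
  rw [this]
  exact isClopen_biInter_finset fun i _ => (isClopen_discrete _).preimage (continuous_apply i)

theorem exists_cylinder_subset {U : Set Cantor} (hU : IsOpen U) {x : Cantor} (hx : x ∈ U) :
    ∃ n, PiNat.cylinder (E := fun _ => ZMod 2) x n ⊆ U := by
  obtain ⟨_, ⟨y, n, rfl⟩, hxn, hn⟩ :=
    (PiNat.isTopologicalBasis_cylinders (fun _ : ℕ => ZMod 2)).exists_subset_of_mem_open hx hU
  refine ⟨n, ?_⟩
  rwa [PiNat.mem_cylinder_iff_eq.1 hxn]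

/-- A nonempty closed set is fat if above each of its finite approximations there is one after
which all values on some whole block are possible. -/
structure IsFat (K : Set Cantor) : Prop where
  isClosed : IsClosed K
  nonempty : K.Nonempty
  exists_block : ∀ x ∈ K, ∀ m, ∃ n ≥ m, ∀ a : Cantor,
    (K ∩ PiNat.cylinder (E := fun _ => ZMod 2) x (blockStart n) ∩ blockCylinder a n).Nonempty

theorem IsFat.inter_isClopen {K c : Set Cantor} (hK : IsFat K) (hc : IsClopen c)
    (hne : (K ∩ c).Nonempty) : IsFat (K ∩ c) where
  isClosed := hK.isClosed.inter hc.isClosed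
  nonempty := hne
  exists_block := by
    rintro x ⟨hxK, hxc⟩ m
    obtain ⟨N, hN⟩ := exists_cylinder_subset hc.isOpen hxc
    obtain ⟨n, hn, h⟩ := hK.exists_block x hxK (max m N)
    refine ⟨n, (le_max_left _ _).trans hn, fun a => ?_⟩
    obtain ⟨w, ⟨hwK, hwx⟩, hwa⟩ := h a
    refine ⟨w, ⟨⟨hwK, hN ?_⟩, hwx⟩, hwa⟩
    exact PiNat.cylinder_anti _ (((le_max_right _ _).trans hn).trans (le_blockStart n)) hwx

theorem isFat_univ : IsFat (univ : Set Cantor) where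
  isClosed := isClosed_univ
  nonempty := univ_nonempty
  exists_block := by
    intro x _ m
    refine ⟨m, le_rfl, fun a => ⟨fun i => if i < blockStart m then x i else a i, ⟨mem_univ _, ?_⟩, ?_⟩⟩
    · intro i hi
      simp [hi]
    · intro i hi
      simp [not_lt.2 hi.1]

/-- Agreeing with `z` on some block past `m` is a dense open condition in `K`, since above every
approximation some late block is free. Baire category gives a point agreeing with `z` on infinitely
many blocks. -/
theorem IsFat.exists_sub_mem_blockNullSet {K : Set Cantor} (hK : IsFat K) (z : Cantor) :
    ∃ x ∈ K, z - x ∈ blockNullSet := by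
  have : CompactSpace K := isCompact_iff_compactSpace.1 hK.isClosed.isCompact
  have : Nonempty K := hK.nonempty.to_subtype
  have hopen : ∀ m : ℕ, IsOpen (⋃ n > m, ((↑) : K → Cantor) ⁻¹' blockCylinder z n) := fun m =>
    isOpen_biUnion fun n _ => (isClopen_blockCylinder z n).isOpen.preimage continuous_subtype_val
  have hdense : ∀ m : ℕ, Dense (⋃ n > m, ((↑) : K → Cantor) ⁻¹' blockCylinder z n) := by
    intro m
    rw [dense_iff_inter_open]
    rintro V hV ⟨x, hxV⟩
    obtain ⟨U, hU, rfl⟩ := isOpen_induced_iff.1 hV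
    obtain ⟨N, hN⟩ := exists_cylinder_subset hU hxV
    obtain ⟨n, hn, h⟩ := hK.exists_block x x.2 (max (m + 1) N)
    obtain ⟨w, ⟨hwK, hwx⟩, hwz⟩ := h z
    refine ⟨⟨w, hwK⟩, hN ?_, ?_⟩
    · exact PiNat.cylinder_anti _ (((le_max_right _ _).trans hn).trans (le_blockStart n)) hwx
    · simp only [mem_iUnion]
      exact ⟨n, (le_max_left _ _).trans hn, hwz⟩
  obtain ⟨x, hx⟩ := (dense_iInter_of_isOpen_nat hopen hdense).nonempty
  refine ⟨x, x.2, mem_blockNullSet.2 fun m => ?_⟩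
  have := mem_iInter.1 hx m
  simp only [mem_iUnion] at this
  obtain ⟨n, hn, h⟩ := this
  refine ⟨n, hn, fun i hi => ?_⟩
  have := h i hi
  simp [this]

/-! ### Fusion of splitting trees -/

/-- `S` is a finite set of closed nonempty subsets of `l` which share a finite approximation and
decide the next block in all possible ways. -/
structure IsSplitting (m : ℕ) (l : Set Cantor) (S : Set (Set Cantor)) : Prop where
  finite : S.Finite
  subset : ∀ s ∈ S, s ⊆ l
  isClosed : ∀ s ∈ S, IsClosed s
  nonempty : ∀ s ∈ S, s.Nonempty
  exists_block : ∃ n ≥ m, (∃ t : Cantor, ∀ s ∈ S,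
      s ⊆ PiNat.cylinder (E := fun _ => ZMod 2) t (blockStart n)) ∧
    ∀ a : Cantor, ∃ s ∈ S, s ⊆ blockCylinder a n

/-- By compactness along a branch, every node keeps a point of the intersection. Hence the siblings
of the node containing `x` realise all patterns on their block, inside the cylinder they share. -/
theorem isFat_of_isSplitting {L : ℕ → Set (Set Cantor)} {ch : ℕ → Set Cantor → Set (Set Cantor)}
    {r : Set Cantor} (hr : IsClosed r) (hrne : r.Nonempty) (hzero : L 0 = {r})
    (hsucc : ∀ m, L (m + 1) = ⋃ l ∈ L m, ch m l)
    (hsplit : ∀ m, ∀ l ∈ L m, IsSplitting m l (ch m l)) :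
    IsFat (⋂ m, ⋃₀ L m) := by
  have hfin : ∀ m, (L m).Finite := by
    intro m
    induction m with
    | zero => simp [hzero]
    | succ m ih =>
      rw [hsucc]
      exact ih.biUnion fun l hl => (hsplit m l hl).finite
  have hclosed : ∀ m, ∀ l ∈ L m, IsClosed l ∧ l.Nonempty := by
    intro m l hl
    cases m with
    | zero =>
      rw [hzero, mem_singleton_iff] at hl
      exact hl ▸ ⟨hr, hrne⟩
    | succ m =>
      simp only [hsucc, mem_iUnion] at hl
      obtain ⟨k, hk, hl⟩ := hl
      exact ⟨(hsplit m k hk).isClosed l hl, (hsplit m k hk).nonempty l hl⟩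
  have hmem : ∀ m, ∀ l ∈ L m, ∀ s ∈ ch m l, s ∈ L (m + 1) := by
    intro m l hl s hs
    rw [hsucc]
    exact mem_biUnion hl hs
  have hanti : Antitone fun m => ⋃₀ L m := by
    refine antitone_nat_of_succ_le fun m => ?_
    rintro x ⟨s, hs, hx⟩
    simp only [hsucc, mem_iUnion] at hs
    obtain ⟨k, hk, hs⟩ := hs
    exact ⟨k, hk, (hsplit m k hk).subset s hs hx⟩
  have hleaf : ∀ m, ∀ l ∈ L m, ((⋂ m, ⋃₀ L m) ∩ l).Nonempty := by
    intro m l hl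
    have hex : ∀ m l, ∃ s, l ∈ L m → s ∈ ch m l := by
      intro m l
      by_cases h : l ∈ L m
      · obtain ⟨n, -, -, h'⟩ := (hsplit m l h).exists_block
        obtain ⟨s, hs, -⟩ := h' 0
        exact ⟨s, fun _ => hs⟩
      · exact ⟨∅, fun h' => (h h').elim⟩
    choose c hc using hex
    let σ : ℕ → Set Cantor := fun j => Nat.rec l (fun j s => c (m + j) s) j
    have hσ : ∀ j, σ j ∈ L (m + j) := by
      intro j
      induction j with
      | zero => exact hl
      | succ j ih => exact hmem _ _ ih _ (hc _ _ ih)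
    obtain ⟨x, hx⟩ := IsCompact.nonempty_iInter_of_sequence_nonempty_isCompact_isClosed σ
      (fun j => (hsplit _ _ (hσ j)).subset _ (hc _ _ (hσ j)))
      (fun j => (hclosed _ _ (hσ j)).2) (hclosed _ _ (hσ 0)).1.isCompact
      (fun j => (hclosed _ _ (hσ j)).1)
    rw [mem_iInter] at hx
    refine ⟨x, mem_iInter.2 fun j => ?_, hx 0⟩
    exact hanti (Nat.le_add_left j m) ⟨σ j, hσ j, hx j⟩
  refine ⟨isClosed_iInter fun m => ?_, ?_, ?_⟩
  · rw [sUnion_eq_biUnion]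
    exact (hfin m).isClosed_biUnion fun l hl => (hclosed m l hl).1
  · exact (hleaf 0 r (by simp [hzero])).mono inter_subset_left
  · intro x hx m
    obtain ⟨s, hs, hxs⟩ := mem_iInter.1 hx (m + 1)
    simp only [hsucc, mem_iUnion] at hs
    obtain ⟨l, hl, hs⟩ := hs
    obtain ⟨n, hn, ⟨t, ht⟩, hb⟩ := (hsplit m l hl).exists_block
    refine ⟨n, hn, fun a => ?_⟩
    obtain ⟨s', hs', hsa⟩ := hb a
    obtain ⟨w, hwK, hws⟩ := hleaf _ _ (hmem m l hl s' hs')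
    refine ⟨w, ⟨hwK, ?_⟩, hsa hws⟩
    rw [PiNat.mem_cylinder_iff_eq.1 (ht s hs hxs)]
    exact ht s' hs' hws

/-! ### Refining a countable family of fat sets -/

/-- A family of fat sets closed under nonempty intersections with clopen sets. -/
structure IsFatFamily (C : Set (Set Cantor)) : Prop where
  isFat : ∀ p ∈ C, IsFat p
  inter_mem : ∀ p ∈ C, ∀ c, IsClopen c → (p ∩ c).Nonempty → p ∩ c ∈ C

/-- `Y` meets every member of `C` contained in `l`. -/
def MeetsBelow (C : Set (Set Cantor)) (Y l : Set Cantor) : Prop :=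
  ∀ r ∈ C, r ⊆ l → (r ∩ Y).Nonempty

theorem MeetsBelow.mono {C : Set (Set Cantor)} {Y l s : Set Cantor} (h : MeetsBelow C Y l)
    (hs : s ⊆ l) : MeetsBelow C Y s :=
  fun r hr hrs => h r hr (hrs.trans hs)

/-- When `Y` is met everywhere below `l`, `F` takes one point of `Y` from each prospective child, so
cutting by a clopen `D ⊇ F` leaves every child nonempty and in `C`. Since `F` is fixed before `D`,
one `D` can serve finitely many nodes. -/
theorem IsFatFamily.exists_isSplitting {C : Set (Set Cantor)} (hC : IsFatFamily C)
    {U : Set Cantor} (hU : ∀ p ∈ C, ∃ q ∈ C, q ⊆ p ∧ q ⊆ U) (Y : Set Cantor) (m : ℕ)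
    {l : Set Cantor} (hl : l ∈ C) :
    ∃ F ⊆ Y, F.Finite ∧ ∀ D, IsClopen D → F ⊆ D → ∃ S, IsSplitting m l S ∧
      ∀ s ∈ S, s ∈ C ∧ s ⊆ U ∧ (MeetsBelow C Y l → s ⊆ D) := by
  obtain ⟨x, hx⟩ := (hC.isFat l hl).nonempty
  obtain ⟨n, hn, hb⟩ := (hC.isFat l hl).exists_block x hx m
  -- Finite patterns padded with zeros keep the set of children finite.
  let e : (Fin (blockStart (n + 1)) → ZMod 2) → Cantor := fun a i =>
    if h : i < blockStart (n + 1) then a ⟨i, h⟩ else 0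
  have hq : ∀ a, ∃ q ∈ C, q ⊆ l ∩ (PiNat.cylinder (E := fun _ => ZMod 2) x (blockStart n) ∩
      blockCylinder (e a) n) ∧ q ⊆ U := by
    intro a
    refine hU _ (hC.inter_mem l hl _ ((isClopen_cylinder _ _).inter (isClopen_blockCylinder _ _)) ?_)
    rw [← inter_assoc]
    exact hb (e a)
  choose q hqC hql hqU using hq
  have hblock : ∀ a : Cantor, ∃ a', blockCylinder (e a') n = blockCylinder a n := by
    intro a
    refine ⟨fun i => a i, ?_⟩
    ext w
    simp only [blockCylinder, mem_ofPred_eq, e]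
    refine forall₂_congr fun i hi => ?_
    rw [dif_pos hi.2]
  have hsplit : ∀ D : Set Cantor, IsClopen D → (∀ a, (q a ∩ D).Nonempty) →
      IsSplitting m l (range fun a => q a ∩ D) := by
    intro D hD hne
    refine ⟨finite_range _, ?_, ?_, ?_, n, hn, ⟨x, ?_⟩, fun a => ?_⟩
    · rintro _ ⟨a, rfl⟩
      exact inter_subset_left.trans ((hql a).trans inter_subset_left)
    · rintro _ ⟨a, rfl⟩
      exact (hC.isFat _ (hqC a)).isClosed.inter hD.isClosed
    · rintro _ ⟨a, rfl⟩
      exact hne a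
    · rintro _ ⟨a, rfl⟩
      exact fun w hw => (hql a hw.1).2.1
    · obtain ⟨a', ha'⟩ := hblock a
      exact ⟨_, ⟨a', rfl⟩, fun w hw => ha' ▸ (hql a' hw.1).2.2⟩
  by_cases hg : MeetsBelow C Y l
  · have hy : ∀ a, ∃ y, y ∈ q a ∩ Y := fun a => hg _ (hqC a) ((hql a).trans inter_subset_left)
    choose y hy using hy
    refine ⟨range y, ?_, finite_range y, fun D hD hyD => ⟨_, hsplit D hD ?_, ?_⟩⟩
    · rintro _ ⟨a, rfl⟩
      exact (hy a).2
    · exact fun a => ⟨y a, (hy a).1, hyD ⟨a, rfl⟩⟩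
    · rintro _ ⟨a, rfl⟩
      exact ⟨hC.inter_mem _ (hqC a) D hD ⟨y a, (hy a).1, hyD ⟨a, rfl⟩⟩,
        inter_subset_left.trans (hqU a), fun _ => inter_subset_right⟩
  · refine ⟨∅, empty_subset _, finite_empty, fun D _ _ => ⟨_, hsplit univ isClopen_univ ?_, ?_⟩⟩
    · intro a
      rw [inter_univ]
      exact (hC.isFat _ (hqC a)).nonempty
    · rintro _ ⟨a, rfl⟩
      dsimp only
      rw [inter_univ]
      exact ⟨hqC a, hqU a, fun h => (hg h).elim⟩

theorem IsFatFamily.exists_isSplitting_of_finite {C : Set (Set Cantor)} (hC : IsFatFamily C)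
    {Y : Set Cantor} {J : Set (Set Cantor)} (hJ : ∀ B ∈ J, IsClopen B)
    (hcov : ∀ F ⊆ Y, F.Finite → ∃ B ∈ J, F ⊆ B)
    {U : Set Cantor} (hU : ∀ p ∈ C, ∃ q ∈ C, q ⊆ p ∧ q ⊆ U) (m : ℕ)
    {L : Set (Set Cantor)} (hL : L.Finite) (hLC : L ⊆ C) {F : Set Cantor} (hF : F.Finite)
    (hFY : F ⊆ Y) :
    ∃ D ∈ J, F ⊆ D ∧ ∃ ch : Set Cantor → Set (Set Cantor), ∀ l ∈ L, IsSplitting m l (ch l) ∧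
      ∀ s ∈ ch l, s ∈ C ∧ s ⊆ U ∧ (MeetsBelow C Y l → s ⊆ D) := by
  have h : ∀ l : Set Cantor, ∃ F ⊆ Y, F.Finite ∧ (l ∈ L → ∀ D, IsClopen D → F ⊆ D →
      ∃ S, IsSplitting m l S ∧ ∀ s ∈ S, s ∈ C ∧ s ⊆ U ∧ (MeetsBelow C Y l → s ⊆ D)) := by
    intro l
    by_cases hl : l ∈ L
    · obtain ⟨F, hFY, hF, h⟩ := hC.exists_isSplitting hU Y m (hLC hl)
      exact ⟨F, hFY, hF, fun _ => h⟩
    · exact ⟨∅, empty_subset _, finite_empty, fun h => (hl h).elim⟩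
  choose E hEY hE h using h
  obtain ⟨D, hD, hFD⟩ := hcov (F ∪ ⋃ l ∈ L, E l) (union_subset hFY (iUnion₂_subset fun l _ => hEY l))
    (hF.union (hL.biUnion fun l _ => hE l))
  have h' : ∀ l, ∃ S, l ∈ L → IsSplitting m l S ∧
      ∀ s ∈ S, s ∈ C ∧ s ⊆ U ∧ (MeetsBelow C Y l → s ⊆ D) := by
    intro l
    by_cases hl : l ∈ L
    · obtain ⟨S, hS⟩ := h l hl D (hJ D hD)
        ((subset_biUnion_of_mem hl).trans (subset_union_right.trans hFD))
      exact ⟨S, fun _ => hS⟩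
    · exact ⟨∅, fun h => (hl h).elim⟩
  choose ch hch using h'
  exact ⟨D, hD, subset_union_left.trans hFD, ch, hch⟩

theorem Set.Countable.exists_finite_exhaustion {α : Type*} {Y : Set α} (hY : Y.Countable) :
    ∃ F : ℕ → Set α, (∀ m, (F m).Finite) ∧ (∀ m, F m ⊆ Y) ∧
      ∀ y ∈ Y, ∃ m, ∀ n ≥ m, y ∈ F n := by
  rcases Y.eq_empty_or_nonempty with rfl | hne
  · exact ⟨fun _ => ∅, by simp, by simp, by simp⟩
  · obtain ⟨f, rfl⟩ := hY.exists_eq_range hne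
    refine ⟨fun m => f '' Iic m, fun m => (finite_Iic m).image f,
      fun m => image_subset_range _ _, ?_⟩
    rintro _ ⟨m, rfl⟩
    exact ⟨m, fun n hn => ⟨m, hn, rfl⟩⟩

/-- A countable family `C` of fat sets is refined by a countable family of fat sets whose members
lie in countably many given sets and which decides a given `ω`-cover of a countable set. -/
theorem IsFatFamily.exists_refinement {C : Set (Set Cantor)} (hC : IsFatFamily C)
    (hCc : C.Countable) {Y : Set Cantor} (hY : Y.Countable) {J : Set (Set Cantor)}
    (hJ : ∀ B ∈ J, IsClopen B) (hcov : ∀ F ⊆ Y, F.Finite → ∃ B ∈ J, F ⊆ B)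
    {U : ℕ → Set Cantor} (hU : ∀ i, ∀ p ∈ C, ∃ q ∈ C, q ⊆ p ∧ q ⊆ U i) :
    ∃ N : Set (Set Cantor), IsFatFamily N ∧ N.Countable ∧ (∀ p ∈ C, ∃ q ∈ N, q ⊆ p) ∧
      (∀ q ∈ N, ∀ i, q ⊆ U i) ∧ ∃ D : ℕ → Set Cantor, (∀ n, D n ∈ J) ∧
        (∀ y ∈ Y, ∃ m, ∀ n > m, y ∈ D n) ∧
        ∀ q ∈ N, (∃ r ∈ C, q ⊆ r ∧ r ∩ Y = ∅) ∨ ∃ m, ∀ n > m, q ⊆ D n := by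
  rcases C.eq_empty_or_nonempty with rfl | hCne
  · obtain ⟨F, hF, hFY, hFe⟩ := hY.exists_finite_exhaustion
    choose D hD hFD using fun m => hcov (F m) (hFY m) (hF m)
    refine ⟨∅, ⟨by simp, by simp⟩, countable_empty, by simp, by simp, D, hD, fun y hy => ?_, by simp⟩
    obtain ⟨m, hm⟩ := hFe y hy
    exact ⟨m, fun n hn => hFD n (hm n hn.le)⟩
  obtain ⟨p, rfl⟩ := hCc.exists_eq_range hCne
  set C := range p
  obtain ⟨F, hF, hFY, hFe⟩ := hY.exists_finite_exhaustion
  -- Shrink each `p i` until it misses `Y` or `Y` meets everything below it; the latter property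
  -- passes to all nodes of the tree.
  have hroot : ∀ i, ∃ r ∈ C, r ⊆ p i ∧ (r ∩ Y = ∅ ∨ MeetsBelow C Y r) := by
    intro i
    by_cases h : MeetsBelow C Y (p i)
    · exact ⟨p i, ⟨i, rfl⟩, subset_rfl, Or.inr h⟩
    · simp only [MeetsBelow, not_forall, not_nonempty_iff_eq_empty] at h
      obtain ⟨r, hr, hrp, h⟩ := h
      exact ⟨r, hr, hrp, Or.inl h⟩
  choose r hrC hrp hr using hroot
  -- All trees grow together, so that one `D` serves every tree already planted. The index
  -- `m.unpair.1` takes each value infinitely often.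
  have hstep := fun (m : ℕ) (L : {L : Set (Set Cantor) // L.Finite ∧ L ⊆ C}) =>
    hC.exists_isSplitting_of_finite hJ hcov (hU m.unpair.1) m L.2.1 L.2.2 (hF m) (hFY m)
  choose D hDJ hFD ch hch using hstep
  let next : (m : ℕ) → {L : Set (Set Cantor) // L.Finite ∧ L ⊆ C} →
      {L : Set (Set Cantor) // L.Finite ∧ L ⊆ C} := fun m L =>
    ⟨(⋃ l ∈ L.1, ch m L l) ∪ {r (m + 1)},
      (L.2.1.biUnion fun l hl => (hch m L l hl).1.finite).union (finite_singleton _),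
      union_subset (iUnion₂_subset fun l hl s hs => ((hch m L l hl).2 s hs).1)
        (singleton_subset_iff.2 (hrC _))⟩
  let T : ℕ → {L : Set (Set Cantor) // L.Finite ∧ L ⊆ C} := fun m =>
    Nat.rec ⟨{r 0}, finite_singleton _, singleton_subset_iff.2 (hrC 0)⟩ next m
  have hTsucc : ∀ m, (T (m + 1)).1 = (⋃ l ∈ (T m).1, ch m (T m) l) ∪ {r (m + 1)} := fun m => rfl
  have hTroot : ∀ m, r m ∈ (T m).1 := by
    intro m
    cases m with
    | zero => exact mem_singleton _
    | succ m =>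
      rw [hTsucc]
      exact Or.inr rfl
  -- Tree `i` is planted at step `i`, so its level `m` consists of nodes active at step `i + m`.
  let L : ℕ → ℕ → Set (Set Cantor) := fun i m =>
    Nat.rec {r i} (fun m L => ⋃ l ∈ L, ch (i + m) (T (i + m)) l) m
  have hLsucc : ∀ i m, L i (m + 1) = ⋃ l ∈ L i m, ch (i + m) (T (i + m)) l := fun i m => rfl
  have hLT : ∀ i m, L i m ⊆ (T (i + m)).1 := by
    intro i m
    induction m with
    | zero => exact singleton_subset_iff.2 (hTroot i)
    | succ m ih =>
      rw [hLsucc, ← add_assoc, hTsucc]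
      exact subset_union_of_subset_left (biUnion_subset_biUnion_left ih) _
  have hLr : ∀ i m, ∀ l ∈ L i m, l ⊆ r i := by
    intro i m
    induction m with
    | zero =>
      intro l hl
      rw [show l = r i from hl]
    | succ m ih =>
      intro s hs
      simp only [hLsucc, mem_iUnion] at hs
      obtain ⟨l, hl, hs⟩ := hs
      exact ((hch _ _ l (hLT i m hl)).1.subset s hs).trans (ih l hl)
  let K : ℕ → Set Cantor := fun i => ⋂ m, ⋃₀ L i m
  have hKfat : ∀ i, IsFat (K i) := by
    intro i
    refine isFat_of_isSplitting (hC.isFat _ (hrC i)).isClosed (hC.isFat _ (hrC i)).nonempty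
      rfl (hLsucc i) fun m l hl => ?_
    have h := (hch (i + m) (T (i + m)) l (hLT i m hl)).1
    obtain ⟨n, hn, h'⟩ := h.exists_block
    exact ⟨h.finite, h.subset, h.isClosed, h.nonempty, n, (Nat.le_add_left m i).trans hn, h'⟩
  have hKr : ∀ i, K i ⊆ r i := by
    intro i x hx
    obtain ⟨l, hl, hxl⟩ := mem_iInter.1 hx 0
    exact hLr i 0 l hl hxl
  have hKleaf : ∀ i m, i ≤ m → ∀ x ∈ K i, ∃ l ∈ (T m).1, l ⊆ r i ∧ ∃ s ∈ ch m (T m) l, x ∈ s := by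
    intro i m him x hx
    obtain ⟨k, rfl⟩ := Nat.exists_eq_add_of_le him
    obtain ⟨s, hs, hxs⟩ := mem_iInter.1 hx (k + 1)
    simp only [hLsucc, mem_iUnion] at hs
    obtain ⟨l, hl, hs⟩ := hs
    exact ⟨l, hLT i k hl, hLr i k l hl, s, hs, hxs⟩
  have hKU : ∀ i j, K i ⊆ U j := by
    intro i j x hx
    -- Step `Nat.pair j i` treats `U j` and does not precede the planting of tree `i`.
    obtain ⟨l, hl, -, s, hs, hxs⟩ := hKleaf i (Nat.pair j i) (Nat.right_le_pair j i) x hx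
    have := ((hch _ _ l hl).2 s hs).2.1 hxs
    rwa [Nat.unpair_pair] at this
  have hKD : ∀ i, MeetsBelow (range p) Y (r i) → ∀ n ≥ i, K i ⊆ D n (T n) := by
    intro i hi n hn x hx
    obtain ⟨l, hl, hlr, s, hs, hxs⟩ := hKleaf i n hn x hx
    exact ((hch _ _ l hl).2 s hs).2.2 (hi.mono hlr) hxs
  refine ⟨{q | ∃ i, ∃ c, IsClopen c ∧ (K i ∩ c).Nonempty ∧ q = K i ∩ c}, ⟨?_, ?_⟩, ?_, ?_, ?_,
    fun n => D n (T n), fun n => hDJ _ _, ?_, ?_⟩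
  · rintro _ ⟨i, c, hc, hne, rfl⟩
    exact (hKfat i).inter_isClopen hc hne
  · rintro _ ⟨i, c, hc, -, rfl⟩ c' hc' hne
    rw [inter_assoc] at hne ⊢
    exact ⟨i, _, hc.inter hc', hne, rfl⟩
  · have : Countable (TopologicalSpace.Clopens Cantor) :=
      TopologicalSpace.Clopens.countable_iff_secondCountable.2 inferInstance
    refine (countable_range fun x : ℕ × TopologicalSpace.Clopens Cantor => K x.1 ∩ x.2).mono ?_
    rintro _ ⟨i, c, hc, -, rfl⟩
    exact ⟨(i, ⟨c, hc⟩), rfl⟩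
  · rintro _ ⟨i, rfl⟩
    refine ⟨K i, ⟨i, univ, isClopen_univ, ?_, (inter_univ _).symm⟩, (hKr i).trans (hrp i)⟩
    rw [inter_univ]
    exact (hKfat i).nonempty
  · rintro _ ⟨i, c, -, -, rfl⟩ j
    exact inter_subset_left.trans (hKU i j)
  · intro y hy
    obtain ⟨m, hm⟩ := hFe y hy
    exact ⟨m, fun n hn => hFD _ _ (hm n hn.le)⟩
  · rintro _ ⟨i, c, -, -, rfl⟩
    rcases hr i with h | h
    · exact Or.inl ⟨r i, hrC i, inter_subset_left.trans (hKr i), h⟩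
    · exact Or.inr ⟨i, fun n hn => inter_subset_left.trans (hKD i h n hn.le)⟩

/-! ### Closure points in $\omega_1$ and guessing by ◇ -/

theorem OmegaOne.countable_Iio (α : OmegaOne) : (Iio α).Countable := by
  rw [← Cardinal.le_aleph0_iff_set_countable, ← Cardinal.lt_aleph_one_iff]
  have h := Cardinal.mk_Iio_lt α (by simp)
  simpa using h

theorem OmegaOne.cof_eq : Order.cof OmegaOne = Cardinal.aleph 1 := by
  rw [← Cardinal.cof_omega_one]
  simp

theorem OmegaOne.exists_forall_lt {s : Set OmegaOne} (hs : s.Countable) : ∃ γ, ∀ β ∈ s, β < γ := by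
  rw [← not_isCofinal_iff]
  intro h
  have h1 := (Order.cof_le h).trans (Cardinal.le_aleph0_iff_set_countable.2 hs)
  rw [OmegaOne.cof_eq] at h1
  exact absurd h1 (not_le.2 Cardinal.aleph0_lt_aleph_one)

theorem OmegaOne.isClub_closed (h : OmegaOne → OmegaOne) (γ : OmegaOne) :
    IsClub {α : OmegaOne | γ < α ∧ ∀ β < α, h β < α} := by
  constructor
  · rintro t ht ⟨c, hc⟩ - a ha
    refine ⟨(ht hc).1.trans_le (ha.1 hc), fun β hβ => ?_⟩
    obtain ⟨c, hc, hβc⟩ := (lt_isLUB_iff ha).1 hβ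
    exact ((ht hc).2 β hβc).trans_le (ha.1 hc)
  · intro a
    have hstep : ∀ b : OmegaOne, ∃ b', ∀ β ∈ insert b (insert γ (h '' Iio b)), β < b' := fun b =>
      OmegaOne.exists_forall_lt ((((OmegaOne.countable_Iio b).image h).insert γ).insert b)
    choose s hs using hstep
    let g : ℕ → OmegaOne := fun n => Nat.rec a (fun _ b => s b) n
    have hg : ∀ n, ∀ β ∈ insert (g n) (insert γ (h '' Iio (g n))), β < g (n + 1) := fun n => hs (g n)
    have hne : (upperBounds (range g)).Nonempty := by
      obtain ⟨b, hb⟩ := OmegaOne.exists_forall_lt (countable_range g)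
      exact ⟨b, fun x hx => (hb x hx).le⟩
    have hlub : IsLUB (range g) (wellFounded_lt.min (upperBounds (range g)) hne) :=
      ⟨WellFounded.min_mem _ _ hne, fun x hx => not_lt.1 (wellFounded_lt.not_lt_min _ hx)⟩
    refine ⟨_, ⟨?_, fun β hβ => ?_⟩, hlub.1 ⟨0, rfl⟩⟩
    · exact (hg 0 γ (by simp)).trans_le (hlub.1 ⟨1, rfl⟩)
    · obtain ⟨_, ⟨n, rfl⟩, hn⟩ := (lt_isLUB_iff hlub).1 hβ
      exact (hg n (h β) (Or.inr (Or.inr ⟨β, hn, rfl⟩))).trans_le (hlub.1 ⟨n + 1, rfl⟩)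

/-- The pair `A`, `T` is coded as one subset of $\omega_1$ by an injection of `ℕ ⊕ OmegaOne`. The
guess at `α` decodes correctly when `α` is closed under the coding, which, like closure under `h`,
holds on a club. -/
theorem Diamond.exists_guess (hD : Diamond) :
    ∃ (a : OmegaOne → Set ℕ) (S : OmegaOne → Set OmegaOne), ∀ (A : Set ℕ) (T : Set OmegaOne)
      (h : OmegaOne → OmegaOne) (γ : OmegaOne),
      ∃ α, γ < α ∧ (∀ β < α, h β < α) ∧ a α = A ∧ ∀ β < α, β ∈ S α ↔ β ∈ T := by
  obtain ⟨G, -, hG⟩ := hD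
  obtain ⟨e⟩ : Nonempty (ℕ ⊕ OmegaOne ↪ OmegaOne) := by
    rw [← Cardinal.le_def, Cardinal.mk_sum]
    simpa using Cardinal.add_le_of_le (Cardinal.aleph0_le_aleph 1) (Cardinal.aleph0_le_aleph 1) le_rfl
  refine ⟨fun α => {n | e (Sum.inl n) ∈ G α}, fun α => {β | e (Sum.inr β) ∈ G α}, fun A T h γ' => ?_⟩
  obtain ⟨γ, hγ⟩ := OmegaOne.exists_forall_lt (countable_range fun n : ℕ => e (Sum.inl n))
  obtain ⟨α, hα, hγα, hcl⟩ := hG (e '' (Sum.inl '' A ∪ Sum.inr '' T))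
    (OmegaOne.isClub_closed (fun β => max (h β) (e (Sum.inr β))) (max γ γ'))
  have hα : e '' (Sum.inl '' A ∪ Sum.inr '' T) ∩ Iio α = G α := hα
  refine ⟨α, (le_max_right _ _).trans_lt hγα, fun β hβ => (le_max_left _ _).trans_lt (hcl β hβ), ?_, fun β hβ => ?_⟩
  · ext n
    have : e (Sum.inl n) < α := (hγ _ ⟨n, rfl⟩).trans ((le_max_left _ _).trans_lt hγα)
    simp [← hα, this]
  · have : e (Sum.inr β) < α := (le_max_right _ _).trans_lt (hcl β hβ)
    simp [← hα, this]

/-! ### The transfinite construction -/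

theorem exists_forall_of_wellFoundedLT {ι V : Type*} [LinearOrder ι] [WellFoundedLT ι] [Nonempty V]
    (P : (ι → V) → ι → V → Prop)
    (hcongr : ∀ g g' α v, (∀ β < α, g β = g' β) → P g α v → P g' α v)
    (hex : ∀ g α, (∀ β < α, P g β (g β)) → ∃ v, P g α v) : ∃ g, ∀ α, P g α (g α) := by
  classical
  let F : ∀ α : ι, (∀ β, β < α → V) → V := fun α ih =>
    Classical.epsilon (P (fun β => if h : β < α then ih β h else Classical.arbitrary V) α)
  let g : ι → V := wellFounded_lt.fix F
  have hg : ∀ α, g α =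
      Classical.epsilon (P (fun β => if β < α then g β else Classical.arbitrary V) α) := by
    intro α
    have := wellFounded_lt.fix_eq F α
    simpa [F, g] using this
  refine ⟨g, fun α => ?_⟩
  induction α using WellFoundedLT.induction with
  | _ α ih =>
    obtain ⟨v, hv⟩ := hex g α ih
    have h := Classical.epsilon_spec
      (⟨v, hcongr g _ α v (fun β hβ => (if_pos hβ).symm) hv⟩ :
        ∃ v, P (fun β => if β < α then g β else Classical.arbitrary V) α v)
    rw [← hg] at h
    exact hcongr _ _ _ _ (fun β hβ => if_pos hβ) h

/-- The nonempty clopen sets together with all sets in the families attached to stages below `α`. -/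
def familyBelow (g : OmegaOne → Set (Set Cantor) × Cantor) (α : OmegaOne) : Set (Set Cantor) :=
  {c | IsClopen c ∧ c.Nonempty} ∪ ⋃ β ∈ Iio α, (g β).1

/-- The points attached to stages in `S` below `α`. -/
def pointsBelow (g : OmegaOne → Set (Set Cantor) × Cantor) (S : Set OmegaOne) (α : OmegaOne) :
    Set Cantor :=
  (fun β => (g β).2) '' (S ∩ Iio α)

/-- The requirements on the family of fat sets and on the point attached to stage `α`. -/
structure IsStage (z : OmegaOne → Cantor) (J : OmegaOne → Set (Set Cantor))
    (S : OmegaOne → Set OmegaOne) (g : OmegaOne → Set (Set Cantor) × Cantor) (α : OmegaOne)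
    (v : Set (Set Cantor) × Cantor) : Prop where
  isFatFamily : IsFatFamily v.1
  countable : v.1.Countable
  exists_subset : ∀ p ∈ familyBelow g α, ∃ q ∈ v.1, q ⊆ p
  subset_sUnion : ∀ q ∈ v.1, ∀ β < α, q ⊆ ⋃₀ (g β).1
  mem_sUnion : v.2 ∈ ⋃₀ v.1
  sub_mem : z α - v.2 ∈ blockNullSet
  decides : (∀ B ∈ J α, IsClopen B) →
    (∀ F ⊆ pointsBelow g (S α) α, F.Finite → ∃ B ∈ J α, F ⊆ B) →
    ∃ D : ℕ → Set Cantor, (∀ n, D n ∈ J α) ∧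
      (∀ y ∈ pointsBelow g (S α) α, ∃ m, ∀ n > m, y ∈ D n) ∧
      ∀ q ∈ v.1, (∃ r ∈ familyBelow g α, q ⊆ r ∧ r ∩ pointsBelow g (S α) α = ∅) ∨
        ∃ m, ∀ n > m, q ⊆ D n

theorem countable_isClopen_nonempty : {c : Set Cantor | IsClopen c ∧ c.Nonempty}.Countable := by
  have : Countable (TopologicalSpace.Clopens Cantor) :=
    TopologicalSpace.Clopens.countable_iff_secondCountable.2 inferInstance
  refine (countable_range fun c : TopologicalSpace.Clopens Cantor => (c : Set Cantor)).mono ?_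
  exact fun c hc => ⟨⟨c, hc.1⟩, rfl⟩

section Stage

variable {z : OmegaOne → Cantor} {J : OmegaOne → Set (Set Cantor)} {S : OmegaOne → Set OmegaOne}
  {g g' : OmegaOne → Set (Set Cantor) × Cantor} {α : OmegaOne} {v : Set (Set Cantor) × Cantor}

theorem familyBelow_congr (h : ∀ β < α, g β = g' β) : familyBelow g α = familyBelow g' α := by
  unfold familyBelow
  congr 1
  exact iUnion₂_congr fun β hβ => by rw [h β hβ]

theorem pointsBelow_congr (h : ∀ β < α, g β = g' β) (T : Set OmegaOne) :
    pointsBelow g T α = pointsBelow g' T α :=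
  image_congr fun β hβ => by rw [h β hβ.2]

theorem IsStage.congr (h : ∀ β < α, g β = g' β) (hs : IsStage z J S g α v) :
    IsStage z J S g' α v where
  isFatFamily := hs.isFatFamily
  countable := hs.countable
  exists_subset := familyBelow_congr h ▸ hs.exists_subset
  subset_sUnion q hq β hβ := h β hβ ▸ hs.subset_sUnion q hq β hβ
  mem_sUnion := hs.mem_sUnion
  sub_mem := hs.sub_mem
  decides := familyBelow_congr h ▸ pointsBelow_congr h (S α) ▸ hs.decides

theorem countable_familyBelow (hs : ∀ β < α, (g β).1.Countable) : (familyBelow g α).Countable :=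
  countable_isClopen_nonempty.union ((OmegaOne.countable_Iio α).biUnion hs)

theorem isFatFamily_familyBelow (hs : ∀ β < α, IsFatFamily (g β).1) :
    IsFatFamily (familyBelow g α) where
  isFat := by
    rintro p (⟨hp, hne⟩ | hp)
    · rw [← univ_inter p] at hne ⊢
      exact isFat_univ.inter_isClopen hp hne
    · obtain ⟨β, hβ, hp⟩ := mem_iUnion₂.1 hp
      exact (hs β hβ).isFat p hp
  inter_mem := by
    rintro p (⟨hp, -⟩ | hp) c hc hne
    · exact Or.inl ⟨hp.inter hc, hne⟩
    · obtain ⟨β, hβ, hp⟩ := mem_iUnion₂.1 hp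
      exact Or.inr (mem_iUnion₂.2 ⟨β, hβ, (hs β hβ).inter_mem p hp c hc hne⟩)

/-- A set born before stage `β` is refined at stage `β`; one born at `β` or later already lies in
the required union. -/
theorem exists_mem_familyBelow (hs : ∀ β < α, IsStage z J S g β (g β)) {β : OmegaOne} (hβ : β < α)
    {p : Set Cantor} (hp : p ∈ familyBelow g α) :
    ∃ q ∈ familyBelow g α, q ⊆ p ∧ q ⊆ ⋃₀ (g β).1 := by
  have hbelow : p ∈ familyBelow g β → ∃ q ∈ familyBelow g α, q ⊆ p ∧ q ⊆ ⋃₀ (g β).1 := by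
    intro h
    obtain ⟨q, hq, hqp⟩ := (hs β hβ).exists_subset p h
    exact ⟨q, Or.inr (mem_iUnion₂.2 ⟨β, hβ, hq⟩), hqp, subset_sUnion_of_mem hq⟩
  rcases hp with hp | hp
  · exact hbelow (Or.inl hp)
  · obtain ⟨δ, hδ, hpδ⟩ := mem_iUnion₂.1 hp
    rcases lt_trichotomy δ β with h | rfl | h
    · exact hbelow (Or.inr (mem_iUnion₂.2 ⟨δ, h, hpδ⟩))
    · exact ⟨p, Or.inr hp, subset_rfl, subset_sUnion_of_mem hpδ⟩
    · exact ⟨p, Or.inr hp, subset_rfl, (hs δ hδ).subset_sUnion p hpδ β h⟩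

theorem exists_isStage (hs : ∀ β < α, IsStage z J S g β (g β)) : ∃ v, IsStage z J S g α v := by
  have hC := isFatFamily_familyBelow fun β hβ => (hs β hβ).isFatFamily
  have hCc := countable_familyBelow fun β hβ => (hs β hβ).countable
  have hY : (pointsBelow g (S α) α).Countable :=
    ((OmegaOne.countable_Iio α).mono inter_subset_right).image _
  -- If the guess is not a clopen ω-cover, `decides` is vacuous and `{univ}` stands in for it.
  obtain ⟨J', hJ', hcov, hJJ⟩ : ∃ J' : Set (Set Cantor), (∀ B ∈ J', IsClopen B) ∧
      (∀ F ⊆ pointsBelow g (S α) α, F.Finite → ∃ B ∈ J', F ⊆ B) ∧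
      ((∀ B ∈ J α, IsClopen B) →
        (∀ F ⊆ pointsBelow g (S α) α, F.Finite → ∃ B ∈ J α, F ⊆ B) → J' = J α) := by
    by_cases h : (∀ B ∈ J α, IsClopen B) ∧
        ∀ F ⊆ pointsBelow g (S α) α, F.Finite → ∃ B ∈ J α, F ⊆ B
    · exact ⟨J α, h.1, h.2, fun _ _ => rfl⟩
    · exact ⟨{univ}, by simp [isClopen_univ], by simp, fun h1 h2 => (h ⟨h1, h2⟩).elim⟩
  -- Inserting `univ` keeps the set to be enumerated nonempty even when no stage precedes `α`.
  obtain ⟨U, hU⟩ := (((OmegaOne.countable_Iio α).image fun β => ⋃₀ (g β).1).insert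
    univ).exists_eq_range (insert_nonempty _ _)
  have hreach : ∀ i, ∀ p ∈ familyBelow g α, ∃ q ∈ familyBelow g α, q ⊆ p ∧ q ⊆ U i := by
    intro i p hp
    rcases hU ▸ mem_range_self i with h | ⟨β, hβ, h⟩
    · exact ⟨p, hp, subset_rfl, h ▸ subset_univ p⟩
    · rw [← h]
      exact exists_mem_familyBelow hs hβ hp
  obtain ⟨N, hN, hNc, hNC, hNU, hD⟩ := hC.exists_refinement hCc hY hJ' hcov hreach
  obtain ⟨q, hq, -⟩ := hNC univ (Or.inl ⟨isClopen_univ, univ_nonempty⟩)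
  obtain ⟨x, hx, hxz⟩ := (hN.isFat q hq).exists_sub_mem_blockNullSet (z α)
  refine ⟨(N, x), hN, hNc, hNC, fun q hq β hβ => ?_, ⟨q, hq, hx⟩, hxz, fun h1 h2 => ?_⟩
  · obtain ⟨i, hi⟩ : ⋃₀ (g β).1 ∈ range U := hU ▸ Or.inr ⟨β, hβ, rfl⟩
    exact hi ▸ hNU q hq i
  · rw [← hJJ h1 h2]
    exact hD

theorem exists_forall_isStage (z : OmegaOne → Cantor) (J : OmegaOne → Set (Set Cantor))
    (S : OmegaOne → Set OmegaOne) : ∃ g, ∀ α, IsStage z J S g α (g α) :=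
  exists_forall_of_wellFoundedLT (IsStage z J S) (fun _ _ _ _ h hs => hs.congr h)
    fun _ _ hs => exists_isStage hs

end Stage

/-! ### The hereditary γ-property and the conclusion -/

theorem exists_isClopen_between {F O : Set Cantor} (hF : F.Finite) (hO : IsOpen O) (h : F ⊆ O) :
    ∃ c, IsClopen c ∧ F ⊆ c ∧ c ⊆ O := by
  choose! n hn using fun x (hx : x ∈ F) => exists_cylinder_subset hO (h hx)
  refine ⟨⋃ x ∈ F, PiNat.cylinder (E := fun _ => ZMod 2) x (n x),
    hF.isClopen_biUnion fun x _ => isClopen_cylinder _ _, fun x hx => ?_, iUnion₂_subset hn⟩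
  exact mem_biUnion hx (PiNat.self_mem_cylinder _ _)

theorem exists_forall_witness_lt (f : OmegaOne → Cantor) {Q : Set (Set Cantor)} (hQ : Q.Countable)
    {Y : Set Cantor} (hY : Y ⊆ range f) :
    ∃ γ, ∀ p ∈ Q, (p ∩ Y).Nonempty → ∃ β < γ, f β ∈ p ∩ Y := by
  have h : ∀ p : Set Cantor, ∃ β, (p ∩ Y).Nonempty → f β ∈ p ∩ Y := by
    intro p
    by_cases hp : (p ∩ Y).Nonempty
    · obtain ⟨y, hy⟩ := hp
      obtain ⟨β, rfl⟩ := hY hy.2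
      exact ⟨β, fun _ => hy⟩
    · obtain ⟨γ, -⟩ := OmegaOne.exists_forall_lt countable_empty
      exact ⟨γ, fun h => (hp h).elim⟩
  choose b hb using h
  obtain ⟨γ, hγ⟩ := OmegaOne.exists_forall_lt (hQ.image b)
  exact ⟨γ, fun p hp hne => ⟨b p, hγ _ ⟨p, hp, rfl⟩, hb p hne⟩⟩

theorem isHereditarilyGamma_range {z : OmegaOne → Cantor} {J : OmegaOne → Set (Set Cantor)}
    {S : OmegaOne → Set OmegaOne} {g : OmegaOne → Set (Set Cantor) × Cantor}
    (hg : ∀ α, IsStage z J S g α (g α))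
    (hguess : ∀ (I : Set (Set Cantor)) (T : Set OmegaOne) (h : OmegaOne → OmegaOne) (γ : OmegaOne),
      (∀ c ∈ I, IsClopen c) →
      ∃ α, γ < α ∧ (∀ β < α, h β < α) ∧ J α = I ∧ ∀ β < α, β ∈ S α ↔ β ∈ T) :
    IsHereditarilyGamma (range fun α => (g α).2) := by
  intro Y hYX K hK hcov
  choose h hh using fun β => exists_forall_witness_lt (fun α => (g α).2) (hg β).countable hYX
  obtain ⟨γ, hγ⟩ := exists_forall_witness_lt (fun α => (g α).2) countable_isClopen_nonempty hYX
  -- The cover is replaced by the clopen sets inside its members, and `α` is closed under the bounds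
  -- `h`, so that sets in `familyBelow g α` meeting `Y` meet it at a point born before `α`.
  obtain ⟨α, hγα, hclosed, hJ, hS⟩ := hguess
    {c | IsClopen c ∧ ∃ B ∈ K, ((↑) : Y → Cantor) ⁻¹' c ⊆ B} {β | (g β).2 ∈ Y} h γ fun c hc => hc.1
  have hYα : pointsBelow g (S α) α ⊆ Y := by
    rintro _ ⟨β, ⟨hβS, hβ⟩, rfl⟩
    exact (hS β hβ).1 hβS
  have hwit : ∀ r ∈ familyBelow g α, (r ∩ Y).Nonempty → (r ∩ pointsBelow g (S α) α).Nonempty := by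
    intro r hr hne
    have : ∃ β < α, (g β).2 ∈ r ∩ Y := by
      rcases hr with hr | hr
      · obtain ⟨β, hβ, hβr⟩ := hγ r hr hne
        exact ⟨β, hβ.trans hγα, hβr⟩
      · obtain ⟨δ, hδ, hr⟩ := mem_iUnion₂.1 hr
        obtain ⟨β, hβ, hβr⟩ := hh δ r hr hne
        exact ⟨β, hβ.trans (hclosed δ hδ), hβr⟩
    obtain ⟨β, hβ, hβr⟩ := this
    exact ⟨(g β).2, hβr.1, β, ⟨(hS β hβ).2 hβr.2, hβ⟩, rfl⟩
  obtain ⟨D, hDJ, hDY, hDN⟩ := (hg α).decides (by rw [hJ]; exact fun c hc => hc.1) (by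
    intro F hFY hF
    obtain ⟨B, hB, hFB⟩ := hcov (((↑) : Y → Cantor) ⁻¹' F) (hF.preimage Subtype.val_injective.injOn)
    obtain ⟨O, hO, rfl⟩ := isOpen_induced_iff.1 (hK B hB)
    obtain ⟨c, hc, hFc, hcO⟩ := exists_isClopen_between hF hO
      fun x hx => @hFB ⟨x, hYα (hFY hx)⟩ hx
    rw [hJ]
    exact ⟨c, ⟨hc, _, hB, preimage_mono hcO⟩, hFc⟩)
  rw [hJ] at hDJ
  choose hDclopen B hBK hDB using hDJ
  refine ⟨B, hBK, eq_univ_of_forall fun y => ?_⟩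
  suffices ∃ m, ∀ n > m, (y : Cantor) ∈ D n by
    obtain ⟨m, hm⟩ := this
    exact mem_iUnion.2 ⟨m, mem_iInter₂.2 fun n hn => hDB n (hm n hn)⟩
  obtain ⟨β, hβ⟩ := hYX y.2
  have hβ : (g β).2 = y := hβ
  rcases lt_or_ge β α with hβα | hαβ
  · exact hDY y ⟨β, ⟨(hS β hβα).2 (hβ ▸ y.2 : (g β).2 ∈ Y), hβα⟩, hβ⟩
  · have hy : (y : Cantor) ∈ ⋃₀ (g α).1 := by
      rcases hαβ.eq_or_lt with rfl | hlt
      · exact hβ ▸ (hg α).mem_sUnion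
      · obtain ⟨q, hq, hyq⟩ := (hg β).mem_sUnion
        exact hβ ▸ (hg β).subset_sUnion q hq α hlt hyq
    obtain ⟨q, hq, hyq⟩ := hy
    rcases hDN q hq with ⟨r, hr, hqr, hrY⟩ | ⟨m, hm⟩
    -- Here `r` contains `y ∈ Y`, hence also an early point of `Y`.
    · exact absurd hrY (hwit r hr ⟨y, hqr hyq, y.2⟩).ne_empty
    · exact ⟨m, fun n hn => hm n hn hyq⟩

theorem theorem2 (hDiamond : Diamond) :
    cantorMeasure blockNullSet = 0 ∧
    ∃ X : Set Cantor, IsHereditarilyGamma X ∧ ¬ IsStronglyMeager X ∧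
      X + blockNullSet = univ := by
  classical
  obtain ⟨a, S, haS⟩ := hDiamond.exists_guess
  have : Countable (TopologicalSpace.Clopens Cantor) :=
    TopologicalSpace.Clopens.countable_iff_secondCountable.2 inferInstance
  obtain ⟨e, he⟩ := exists_surjective_nat (TopologicalSpace.Clopens Cantor)
  -- The guessed set `a α` is read in two ways: as the characteristic function of a point and as a
  -- set of codes of clopen sets.
  obtain ⟨g, hg⟩ := exists_forall_isStage (fun α i => if i ∈ a α then 1 else 0)
    (fun α => (fun n => (e n : Set Cantor)) '' a α) S
  obtain ⟨γ, -⟩ := OmegaOne.exists_forall_lt countable_empty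
  have hX : (range fun α => (g α).2) + blockNullSet = univ := by
    refine eq_univ_of_forall fun y => ?_
    obtain ⟨α, -, -, hα, -⟩ := haS {i | y i = 1} ∅ id γ
    refine mem_add.2 ⟨(g α).2, ⟨α, rfl⟩, y - (g α).2, ?_, add_sub_cancel _ _⟩
    convert (hg α).sub_mem using 2
    ext1 i
    have h01 : ∀ t : ZMod 2, t = if t = 1 then 1 else 0 := by decide
    simpa [hα] using h01 (y i)
  refine ⟨cantorMeasure_blockNullSet, _, isHereditarilyGamma_range hg ?_,
    fun h => h _ cantorMeasure_blockNullSet hX, hX⟩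
  intro I T h γ hI
  obtain ⟨α, hγ, hh, hα, hS⟩ := haS {n | (e n : Set Cantor) ∈ I} T h γ
  refine ⟨α, hγ, hh, ?_, hS⟩
  rw [hα]
  ext c
  constructor
  · rintro ⟨n, hn, rfl⟩
    exact hn
  · intro hc
    obtain ⟨n, hn⟩ := he ⟨c, hI c hc⟩
    have hn : (e n : Set Cantor) = c := by rw [hn]; rfl
    exact ⟨n, by simpa [hn] using hc, hn⟩
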